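/- Let $A=(Q,\Sigma,\lambda,\mu,\{M_a\}_{a\in\Sigma})$ be a weighted automaton over $\mathbb{R}_{\ge 0}$ with finite alphabet $\Sigma$ and finite state set $Q$, computing $f_A(w_1\cdots w_n)=\lambda^{\top}M_{w_1}\cdots M_{w_n}\mu$, and assume that $f_A$ is not identically zero. Let $M=\sum_{a\in\Sigma}M_a$, with spectral radius $\rho(M)$. For $\zeta>0$ let $A_\zeta$ be the automaton obtained from $A$ by replacing each $M_a$ by $\frac1\zeta M_a$, and write $\|f\|_1=\sum_{w\in\Sigma^*}f(w)$. Stochastic regular expressions (SREs) over $\Sigma$ are generated by $$r ::= \delta_\varepsilon \mid \delta_\sigma \mid \alpha r_1+(1-\alpha)r_2 \mid r_1\cdot r_2 \mid r^*_\alpha\qquad(\sigma\in\Sigma,\ \alpha\in(0,1)),$$ where $\varepsilon$ is the empty word. Their semantics $\llbracket r\rrbracket$ is as follows: $\llbracket\delta_u\rrbracket$ is the point mass at $u$; convex combinations are pointwise; $\llbracket r_1\cdot r_2\rrbracket(w)=\sum_{w=uv}\llbracket r_1\rrbracket(u)\llbracket r_2\rrbracket(v)$; and $$\llbracket r^*_\alpha\rrbracket(w)=\sum_{k\ge1}\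 \sum_{w=w_1\cdots w_k,\ w_i\ne\varepsilon}\alpha(1-\alpha)^{k-1}\prod_{i=1}^k\llbracket r\rrbracket(w_i).$$ Let $\zeta=(1+\epsilon)\rho(M)$ with an arbitrary real $\epsilon>0$ if $\rho(M)>0$, and let $\zeta>0$ be arbitrary if $\rho(M)=0$. Then $Z=\|f_{A_\zeta}\|_1$ satisfies $0<Z<\infty$, and there is an SRE $r$ with $\sum_{w\in\Sigma^*}\llbracket r\rrbracket(w)=1$ such that $$f_A(w)=\zeta^{|w|}\cdot Z\cdot\llbracket r\rrbracket(w)\qquad\text{for all } w\in\Sigma^*.$$ Moreover, if $f_A(\varepsilon)=0$, then $r$ can be chosen without the constant $\delta_\varepsilon$. -/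

import Mathlib

open scoped NNReal ENNReal

/-- A weighted finite automaton over the semiring of nonnegative reals, with alphabet `S` and
state set `Q`: initial weights, one transition matrix for each letter, final weights. -/
structure WeightedAutomaton (S Q : Type*) where
  init : Q → ℝ≥0
  trans : S → Matrix Q Q ℝ≥0
  final : Q → ℝ≥0

namespace WeightedAutomaton

variable {S Q : Type*} [Fintype S] [Fintype Q] [DecidableEq Q]

/-- The function computed by the automaton: `f_A(w₁ ⋯ wₙ) = λᵀ M_{w₁} ⋯ M_{wₙ} μ`. -/
def behavior (A : WeightedAutomaton S Q) (w : List S) : ℝ≥0 :=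
  A.init ⬝ᵥ ((w.map A.trans).prod.mulVec A.final)

/-- The joint transition matrix `M = ∑ₐ Mₐ`. -/
def joint (A : WeightedAutomaton S Q) : Matrix Q Q ℝ≥0 :=
  ∑ a, A.trans a

/-- The spectral radius `ρ(M)` of the joint transition matrix: the largest modulus of a complex
eigenvalue (it is `0` if there are no states). -/
noncomputable def rho (A : WeightedAutomaton S Q) : ℝ≥0 :=
  (spectralRadius ℂ (A.joint.map fun x : ℝ≥0 => ((x : ℝ) : ℂ))).toNNReal

/-- The rescaled automaton `A_ζ`: transition matrices are divided by `ζ`, initial and final weights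
are unchanged. -/
noncomputable def rescale (A : WeightedAutomaton S Q) (ζ : ℝ≥0) : WeightedAutomaton S Q where
  init := A.init
  trans a := ζ⁻¹ • A.trans a
  final := A.final

/-- The total mass `‖f_A‖₁ = ∑_w f_A(w)`, a priori possibly infinite. -/
noncomputable def mass (A : WeightedAutomaton S Q) : ℝ≥0∞ :=
  ∑' w : List S, (A.behavior w : ℝ≥0∞)

end WeightedAutomaton

/-- Stochastic regular expressions over the alphabet `S`, with an additional constant `eps` for the
empty word. All parameters lie in the open interval `(0,1)`. -/
inductive SRE (S : Type*) where
  | eps : SRE S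
  | letter (a : S) : SRE S
  | choice (p : Set.Ioo (0 : ℝ≥0) 1) (r₁ r₂ : SRE S) : SRE S
  | mul (r₁ r₂ : SRE S) : SRE S
  | star (p : Set.Ioo (0 : ℝ≥0) 1) (r : SRE S) : SRE S

namespace SRE

variable {S : Type*}

/-- The expressions that do not use the constant `eps`, that is, those generated from letters by
convex combination, product and geometric star alone. -/
def EpsFree : SRE S → Prop
  | eps => False
  | letter _ => True
  | choice _ r₁ r₂ => r₁.EpsFree ∧ r₂.EpsFree
  | mul r₁ r₂ => r₁.EpsFree ∧ r₂.EpsFree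
  | star _ r => r.EpsFree

/-- The factorizations `w = w₁ ⋯ w_k` of `w` into exactly `k` nonempty words. -/
abbrev Factorization (k : ℕ) (w : List S) : Type _ :=
  {l : List (List S) // l.length = k ∧ (∀ u ∈ l, u ≠ []) ∧ l.flatten = w}

/-- The semantics `⟦r⟧`. The sums are taken in `[0,∞]`, so that no convergence question arises.
In the geometric star the index `k` is the number of factors minus one. -/
noncomputable def sem : SRE S → List S → ℝ≥0∞
  | eps, w => Set.indicator {[]} 1 w
  | letter a, w => Set.indicator {[a]} 1 w
  | choice p r₁ r₂, w => ((p : ℝ≥0) : ℝ≥0∞) * r₁.sem w + (1 - ((p : ℝ≥0) : ℝ≥0∞)) * r₂.sem w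
  | mul r₁ r₂, w => ∑' x : {x : List S × List S // x.1 ++ x.2 = w}, r₁.sem x.1.1 * r₂.sem x.1.2
  | star p r, w => ∑' k : ℕ, ∑' l : Factorization (k + 1) w,
      ((p : ℝ≥0) : ℝ≥0∞) * (1 - ((p : ℝ≥0) : ℝ≥0∞)) ^ k * (l.1.map r.sem).prod

end SRE

/-! Since ζ > ρ(M), Gelfand's formula makes the powers of M/ζ summable entrywise
(`tsum_pow_joint_rescale_lt_top`), so the paths of `A_ζ` between any two states have finite total
mass. Kleene's state elimination builds the series of nonempty paths from letters by sums, products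
and stars; the point is that every step stays among nonnegative multiples of eps-free SREs
(`IsScaledSRE`). A sum of multiples is a multiple of a convex combination, scalars of products
multiply, and for 0 < c < 1 the unnormalized plus of `c * ⟦r⟧` is a multiple of a geometric star
(`exists_plus`). The bound c < 1 comes from finiteness: a loop of mass at least 1 could be iterated
to infinite mass (`isScaledSRE_pathSeries`).

The empty word stays outside all stars and is mixed in once at the end. As the resulting SRE has
mass one, its scalar factor is forced to be Z. -/

namespace WordSeries

/-! ### Convolution of word series, Arden's rule and powers -/

/-- The Cauchy product of two formal power series over words. -/
noncomputable def conv {S : Type*} : (List S → ℝ≥0∞) → (List S → ℝ≥0∞) → List S → ℝ≥0∞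
  | f, g, [] => f [] * g []
  | f, g, a :: w => f [] * g (a :: w) + conv (fun u => f (a :: u)) g w

variable {S : Type*}

theorem conv_nil (f g : List S → ℝ≥0∞) : conv f g [] = f [] * g [] := rfl

theorem conv_cons (f g : List S → ℝ≥0∞) (a : S) (w : List S) :
    conv f g (a :: w) = f [] * g (a :: w) + conv (fun u => f (a :: u)) g w := rfl

theorem tsum_list (h : List S → ℝ≥0∞) : ∑' w, h w = h [] + ∑' a, ∑' w, h (a :: w) := by
  let e : Unit ⊕ (S × List S) ≃ List S :=
    { toFun := fun x => x.elim (fun _ => []) (fun y => y.1 :: y.2)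
      invFun := fun w => match w with
        | [] => .inl ()
        | a :: w => .inr (a, w)
      left_inv := by rintro (_ | ⟨a, w⟩) <;> rfl
      right_inv := by rintro (_ | ⟨a, w⟩) <;> rfl }
  rw [← e.tsum_eq h, Summable.tsum_sum ENNReal.summable ENNReal.summable, ENNReal.tsum_prod']
  simp [e]

theorem conv_eq_tsum_tsum [DecidableEq (List S)] (f g : List S → ℝ≥0∞) (w : List S) :
    conv f g w = ∑' u, ∑' v, if u ++ v = w then f u * g v else 0 := by
  classical
  induction w generalizing f with
  | nil =>
    rw [tsum_list]
    simp [conv_nil]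
  | cons a w ih =>
    rw [tsum_list, conv_cons, ih]
    congr 1
    · simp
    · rw [tsum_eq_single a]
      · simp
      · intro b hb
        simp [hb]

theorem tsum_subtype_eq_ite {X : Type*} (p : X → Prop) [DecidablePred p] (F : X → ℝ≥0∞) :
    ∑' x : {x // p x}, F x = ∑' x, if p x then F x else 0 := by
  refine (tsum_subtype {x | p x} F).trans ?_
  simp [Set.indicator_apply]

theorem tsum_splittings_eq_conv (f g : List S → ℝ≥0∞) (w : List S) :
    ∑' x : {x : List S × List S // x.1 ++ x.2 = w}, f x.1.1 * g x.1.2 = conv f g w := by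
  classical
  rw [conv_eq_tsum_tsum, tsum_subtype_eq_ite (fun x : List S × List S => x.1 ++ x.2 = w)
    (fun x => f x.1 * g x.2), ENNReal.tsum_prod']

theorem tsum_conv (f g : List S → ℝ≥0∞) : ∑' w, conv f g w = (∑' w, f w) * ∑' w, g w := by
  classical
  simp_rw [conv_eq_tsum_tsum]
  rw [ENNReal.tsum_comm, ← ENNReal.tsum_mul_right]
  refine tsum_congr fun u => ?_
  rw [ENNReal.tsum_comm, ← ENNReal.tsum_mul_left]
  exact tsum_congr fun v => by simp

theorem conv_add_left (f₁ f₂ g : List S → ℝ≥0∞) (w : List S) :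
    conv (fun u => f₁ u + f₂ u) g w = conv f₁ g w + conv f₂ g w := by
  induction w generalizing f₁ f₂ with
  | nil => simp [conv_nil, add_mul]
  | cons a w ih => simp only [conv_cons, ih]; ring

theorem conv_mul_left (c : ℝ≥0∞) (f g : List S → ℝ≥0∞) (w : List S) :
    conv (fun u => c * f u) g w = c * conv f g w := by
  induction w generalizing f with
  | nil => simp [conv_nil, mul_assoc]
  | cons a w ih => simp only [conv_cons, ih]; ring

theorem conv_add_right (f g₁ g₂ : List S → ℝ≥0∞) (w : List S) :
    conv f (fun u => g₁ u + g₂ u) w = conv f g₁ w + conv f g₂ w := by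
  induction w generalizing f with
  | nil => simp [conv_nil, mul_add]
  | cons a w ih => simp only [conv_cons, ih]; ring

theorem conv_mul_right (c : ℝ≥0∞) (f g : List S → ℝ≥0∞) (w : List S) :
    conv f (fun u => c * g u) w = c * conv f g w := by
  induction w generalizing f with
  | nil => simp only [conv_nil]; ring
  | cons a w ih => simp only [conv_cons, ih]; ring

theorem conv_zero_left (g : List S → ℝ≥0∞) (w : List S) : conv (fun _ => 0) g w = 0 := by
  simpa using conv_mul_left 0 (fun _ => 0) g w

theorem conv_zero_right (f : List S → ℝ≥0∞) (w : List S) : conv f (fun _ => 0) w = 0 := by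
  simpa using conv_mul_right 0 f (fun _ => 0) w

theorem conv_sum_left {ι : Type*} (s : Finset ι) (f : ι → List S → ℝ≥0∞) (g : List S → ℝ≥0∞)
    (w : List S) : conv (fun u => ∑ i ∈ s, f i u) g w = ∑ i ∈ s, conv (f i) g w := by
  classical
  induction s using Finset.induction_on with
  | empty => simpa using conv_zero_left g w
  | insert i s hi ih => simp only [Finset.sum_insert hi, conv_add_left, ih]

theorem conv_ite_nil_left (c : ℝ≥0∞) (g : List S → ℝ≥0∞) (w : List S) :
    conv (fun u => if u = [] then c else 0) g w = c * g w := by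
  cases w with
  | nil => simp [conv_nil]
  | cons a w => simp [conv_cons, conv_zero_left]

theorem conv_assoc (f g h : List S → ℝ≥0∞) (w : List S) :
    conv (conv f g) h w = conv f (conv g h) w := by
  induction w generalizing f with
  | nil => simp [conv_nil, mul_assoc]
  | cons a w ih =>
    simp only [conv_cons, conv_nil, conv_add_left, conv_mul_left, ih]
    ring

/-- A proper left factor consumes at least one letter, so only values of the right factor on shorter
words matter. This drives the induction on length in Arden's rule. -/
theorem conv_congr_right_of_proper {f g₁ g₂ : List S → ℝ≥0∞} (hf : f [] = 0) (w : List S)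
    (h : ∀ v, v.length < w.length → g₁ v = g₂ v) : conv f g₁ w = conv f g₂ w := by
  have aux : ∀ (w : List S) (f : List S → ℝ≥0∞), (∀ v, v.length ≤ w.length → g₁ v = g₂ v) →
      conv f g₁ w = conv f g₂ w := by
    intro w
    induction w with
    | nil => intro f h; simp [conv_nil, h [] le_rfl]
    | cons a w ih =>
      intro f h
      rw [conv_cons, conv_cons, h _ le_rfl, ih _ fun v hv => h v (hv.trans (by simp))]
  cases w with
  | nil => simp [conv_nil, hf]
  | cons a w =>
    rw [conv_cons, conv_cons, hf, zero_mul, zero_mul,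
      aux w _ fun v hv => h v (by simpa using Nat.lt_succ_of_le hv)]

/-- Arden's rule: a linear equation with proper coefficient has at most one solution. -/
theorem eq_of_linear_equation {f h X Y : List S → ℝ≥0∞} (hf : f [] = 0)
    (hX : ∀ w, X w = h w + conv f X w) (hY : ∀ w, Y w = h w + conv f Y w) : X = Y := by
  have : ∀ n, ∀ w : List S, w.length = n → X w = Y w := by
    intro n
    induction n using Nat.strong_induction_on with
    | _ n ih =>
      intro w hw
      rw [hX, hY, conv_congr_right_of_proper hf w fun v hv => ih _ (hw ▸ hv) v rfl]
  exact funext fun w => this _ w rfl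

/-- Powers of a series, `powSucc f k` being the power with exponent `k + 1`. -/
noncomputable def powSucc (f : List S → ℝ≥0∞) : ℕ → List S → ℝ≥0∞
  | 0 => f
  | k + 1 => conv f (powSucc f k)

theorem tsum_powSucc (f : List S → ℝ≥0∞) (k : ℕ) :
    ∑' w, powSucc f k w = (∑' w, f w) ^ (k + 1) := by
  induction k with
  | zero => simp [powSucc]
  | succ k ih => rw [powSucc, tsum_conv, ih, ← pow_succ']

/-- A list with an empty factor contributes zero because `f [] = 0`, so the nonemptiness condition
can be dropped. -/
theorem tsum_factorization_eq_tsum_ite [DecidableEq S] (f : List S → ℝ≥0∞) (hf : f [] = 0) (k : ℕ)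
    (w : List S) : ∑' l : SRE.Factorization k w, (l.1.map f).prod =
      ∑' l : List (List S), if l.length = k ∧ l.flatten = w then (l.map f).prod else 0 := by
  classical
  rw [tsum_subtype_eq_ite
    (fun l : List (List S) => l.length = k ∧ (∀ u ∈ l, u ≠ []) ∧ l.flatten = w)
    (fun l => (l.map f).prod)]
  refine tsum_congr fun l => ?_
  by_cases hl : ∀ u ∈ l, u ≠ []
  · exact if_congr (and_congr_right' (and_iff_right hl)) rfl rfl
  · have h0 : (l.map f).prod = 0 := by
      push Not at hl
      obtain ⟨u, hu, rfl⟩ := hl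
      exact List.prod_eq_zero (List.mem_map.2 ⟨[], hu, hf⟩)
    simp [h0]

theorem tsum_factorization_eq_powSucc (f : List S → ℝ≥0∞) (hf : f [] = 0) (k : ℕ) (w : List S) :
    ∑' l : SRE.Factorization (k + 1) w, (l.1.map f).prod = powSucc f k w := by
  classical
  rw [tsum_factorization_eq_tsum_ite f hf]
  induction k generalizing w with
  | zero =>
    rw [tsum_list]
    simp only [List.length_nil, zero_add, Nat.zero_ne_one, false_and, if_false, powSucc]
    rw [tsum_eq_single w]
    · rw [tsum_list]; simp
    · intro u hu
      rw [tsum_list]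
      simp [hu]
  | succ k ih =>
    rw [tsum_list, powSucc, conv_eq_tsum_tsum]
    simp only [List.length_nil, List.length_cons, List.flatten_cons, List.map_cons, List.prod_cons]
    rw [if_neg (by simp), zero_add]
    refine tsum_congr fun u => ?_
    simp_rw [← ih]
    -- The condition `v = l.flatten` is made explicit so that, after exchanging the sums, the sum
    -- over `v` collapses.
    have : ∀ v : List S, (if u ++ v = w then f u * ∑' l : List (List S),
        (if l.length = k + 1 ∧ l.flatten = v then (l.map f).prod else 0) else 0) =
        ∑' l : List (List S), if v = l.flatten then
          (if l.length = k + 1 ∧ u ++ l.flatten = w then f u * (l.map f).prod else 0) else 0 := by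
      intro v
      split_ifs with h
      · rw [← ENNReal.tsum_mul_left]
        refine tsum_congr fun l => ?_
        by_cases hl : v = l.flatten
        · subst hl; simp [h]
        · simp [hl, Ne.symm hl]
      · symm
        rw [ENNReal.tsum_eq_zero]
        intro l
        by_cases hl : v = l.flatten
        · subst hl; simp [h]
        · simp [hl]
    simp_rw [this]
    rw [ENNReal.tsum_comm]
    refine tsum_congr fun l => ?_
    simp

end WordSeries

open WordSeries

/-! ### Mass and fixed-point equation of SREs -/

namespace SRE

variable {S : Type*}

theorem sem_mul (r₁ r₂ : SRE S) (w : List S) : (mul r₁ r₂).sem w = conv r₁.sem r₂.sem w := by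
  rw [sem, tsum_splittings_eq_conv]

theorem sem_star {r : SRE S} (hr : r.sem [] = 0) (p : Set.Ioo (0 : ℝ≥0) 1) (w : List S) :
    (star p r).sem w = ∑' k : ℕ, ((p : ℝ≥0) : ℝ≥0∞) * (1 - ((p : ℝ≥0) : ℝ≥0∞)) ^ k *
      powSucc r.sem k w := by
  rw [sem]
  simp_rw [ENNReal.tsum_mul_left, tsum_factorization_eq_powSucc r.sem hr]

theorem sem_nil_of_epsFree : ∀ {r : SRE S}, r.EpsFree → r.sem [] = 0
  | letter a, _ => by simp [sem]
  | choice p r₁ r₂, h => by simp [sem, sem_nil_of_epsFree h.1, sem_nil_of_epsFree h.2]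
  | mul r₁ r₂, h => by simp [sem_mul, conv_nil, sem_nil_of_epsFree h.1]
  | star p r, h => by
    have h0 : r.sem [] = 0 := sem_nil_of_epsFree h
    have (k : ℕ) : powSucc r.sem k [] = 0 := by
      cases k <;> simp [powSucc, conv_nil, h0]
    simp [sem_star h0, this]

theorem coe_add_one_sub (p : Set.Ioo (0 : ℝ≥0) 1) :
    ((p : ℝ≥0) : ℝ≥0∞) + (1 - ((p : ℝ≥0) : ℝ≥0∞)) = 1 :=
  add_tsub_cancel_of_le (by exact_mod_cast p.2.2.le)

theorem tsum_indicator_singleton (u : List S) :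
    ∑' w, Set.indicator {u} (1 : List S → ℝ≥0∞) w = 1 := by
  rw [tsum_eq_single u] <;> simp +contextual

theorem tsum_sem_choice (p : Set.Ioo (0 : ℝ≥0) 1) {r₁ r₂ : SRE S} (h₁ : ∑' w, r₁.sem w = 1)
    (h₂ : ∑' w, r₂.sem w = 1) : ∑' w, (choice p r₁ r₂).sem w = 1 := by
  simp only [sem]
  rw [ENNReal.tsum_add, ENNReal.tsum_mul_left, ENNReal.tsum_mul_left, h₁, h₂, mul_one, mul_one,
    coe_add_one_sub]

/-- Eps-freeness matters for the star: its factors must be nonempty, so mass of the body at `[]`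
would be lost; the star of `eps` has mass 0. -/
theorem tsum_sem_of_epsFree : ∀ {r : SRE S}, r.EpsFree → ∑' w, r.sem w = 1
  | letter a, _ => tsum_indicator_singleton [a]
  | choice p r₁ r₂, h =>
    tsum_sem_choice p (tsum_sem_of_epsFree h.1) (tsum_sem_of_epsFree h.2)
  | mul r₁ r₂, h => by
    simp_rw [sem_mul]
    rw [tsum_conv, tsum_sem_of_epsFree h.1, tsum_sem_of_epsFree h.2, one_mul]
  | star p r, h => by
    have h1 : ∑' w, r.sem w = 1 := tsum_sem_of_epsFree h
    simp_rw [sem_star (sem_nil_of_epsFree (show r.EpsFree from h))]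
    rw [ENNReal.tsum_comm]
    simp_rw [ENNReal.tsum_mul_left, tsum_powSucc, h1, one_pow, mul_one]
    rw [ENNReal.tsum_mul_left, ENNReal.tsum_geometric,
      ENNReal.sub_sub_cancel ENNReal.one_ne_top (by exact_mod_cast p.2.2.le)]
    exact ENNReal.mul_inv_cancel (by exact_mod_cast p.2.1.ne') ENNReal.coe_ne_top

theorem sem_star_eq_add_conv {r : SRE S} (hr : r.EpsFree) (p : Set.Ioo (0 : ℝ≥0) 1)
    (w : List S) : (star p r).sem w = ((p : ℝ≥0) : ℝ≥0∞) * r.sem w +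
      (1 - ((p : ℝ≥0) : ℝ≥0∞)) * conv r.sem (star p r).sem w := by
  classical
  have h0 := sem_nil_of_epsFree hr
  rw [sem_star h0, tsum_eq_zero_add' ENNReal.summable]
  congr 1
  · simp [powSucc]
  · simp_rw [conv_eq_tsum_tsum, powSucc, sem_star h0]
    simp_rw [conv_eq_tsum_tsum]
    simp_rw [← ENNReal.tsum_mul_left]
    rw [ENNReal.tsum_comm]
    refine tsum_congr fun u => ?_
    rw [ENNReal.tsum_comm]
    refine tsum_congr fun v => ?_
    split_ifs with h
    · rw [← ENNReal.tsum_mul_left]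
      exact tsum_congr fun k => by ring
    · simp

end SRE

/-! ### Closure properties of scaled SREs -/

namespace WordSeries

variable {S : Type*}

/-- A series is a scaled regular expression if it is zero, or a positive multiple of the semantics
of a stochastic regular expression without the constant `eps`. -/
def IsScaledSRE (f : List S → ℝ≥0∞) : Prop :=
  f = (fun _ => 0) ∨ ∃ c : ℝ≥0, c ≠ 0 ∧ ∃ r : SRE S, r.EpsFree ∧ f = fun w => c * r.sem w

theorem exists_convex_weight {c₁ c₂ : ℝ≥0} (h₁ : c₁ ≠ 0) (h₂ : c₂ ≠ 0) :
    ∃ p : Set.Ioo (0 : ℝ≥0) 1, ((c₁ + c₂ : ℝ≥0) : ℝ≥0∞) * ((p : ℝ≥0) : ℝ≥0∞) = c₁ ∧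
      ((c₁ + c₂ : ℝ≥0) : ℝ≥0∞) * (1 - ((p : ℝ≥0) : ℝ≥0∞)) = c₂ := by
  have h₁' := pos_iff_ne_zero.2 h₁
  have h₂' := pos_iff_ne_zero.2 h₂
  have hc : c₁ + c₂ ≠ 0 := (add_pos h₁' h₂').ne'
  have hp : (c₁ + c₂) * (c₁ / (c₁ + c₂)) = c₁ := mul_div_cancel₀ _ hc
  refine ⟨⟨c₁ / (c₁ + c₂), div_pos h₁' (add_pos h₁' h₂'), ?_⟩, ?_, ?_⟩
  · rw [div_lt_one (add_pos h₁' h₂')]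
    exact lt_add_of_pos_right _ h₂'
  · exact_mod_cast hp
  · have : (c₁ + c₂) * (1 - c₁ / (c₁ + c₂)) = c₂ := by
      rw [mul_tsub, hp, mul_one, add_tsub_cancel_left]
    exact_mod_cast this

namespace IsScaledSRE

theorem zero : IsScaledSRE (fun _ : List S => (0 : ℝ≥0∞)) := Or.inl rfl

theorem apply_nil {f : List S → ℝ≥0∞} (hf : IsScaledSRE f) : f [] = 0 := by
  rcases hf with rfl | ⟨c, hc, r, hr, rfl⟩
  · rfl
  · simp [SRE.sem_nil_of_epsFree hr]

theorem add {f g : List S → ℝ≥0∞} (hf : IsScaledSRE f) (hg : IsScaledSRE g) :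
    IsScaledSRE (fun w => f w + g w) := by
  rcases hf with rfl | ⟨c₁, hc₁, r₁, hr₁, rfl⟩
  · simpa using hg
  rcases hg with rfl | ⟨c₂, hc₂, r₂, hr₂, rfl⟩
  · simp only [add_zero]
    exact Or.inr ⟨c₁, hc₁, r₁, hr₁, rfl⟩
  obtain ⟨p, hp₁, hp₂⟩ := exists_convex_weight hc₁ hc₂
  refine Or.inr ⟨c₁ + c₂, by positivity, .choice p r₁ r₂, ⟨hr₁, hr₂⟩, funext fun w => ?_⟩
  rw [SRE.sem, mul_add, ← mul_assoc, ← mul_assoc, hp₁, hp₂]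

theorem sum {ι : Type*} (s : Finset ι) {f : ι → List S → ℝ≥0∞}
    (hf : ∀ i ∈ s, IsScaledSRE (f i)) : IsScaledSRE (fun w => ∑ i ∈ s, f i w) := by
  classical
  induction s using Finset.induction_on with
  | empty => simpa using zero
  | insert i s hi ih =>
    simp only [Finset.sum_insert hi]
    exact (hf i (by simp)).add (ih fun j hj => hf j (by simp [hj]))

theorem const_mul (c : ℝ≥0) {f : List S → ℝ≥0∞} (hf : IsScaledSRE f) :
    IsScaledSRE (fun w => c * f w) := by
  rcases hf with rfl | ⟨d, hd, r, hr, rfl⟩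
  · simpa using zero
  by_cases hc : c = 0
  · simpa [hc] using zero
  · exact Or.inr ⟨c * d, mul_ne_zero hc hd, r, hr, funext fun w => by
      rw [ENNReal.coe_mul, mul_assoc]⟩

theorem conv {f g : List S → ℝ≥0∞} (hf : IsScaledSRE f) (hg : IsScaledSRE g) :
    IsScaledSRE (conv f g) := by
  rcases hf with rfl | ⟨c₁, hc₁, r₁, hr₁, rfl⟩
  · exact Or.inl (funext fun w => conv_zero_left g w)
  rcases hg with rfl | ⟨c₂, hc₂, r₂, hr₂, rfl⟩
  · exact Or.inl (funext fun w => conv_zero_right _ w)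
  refine Or.inr ⟨c₁ * c₂, mul_ne_zero hc₁ hc₂, .mul r₁ r₂, ⟨hr₁, hr₂⟩, funext fun w => ?_⟩
  rw [conv_mul_left, conv_mul_right, SRE.sem_mul, ENNReal.coe_mul, mul_assoc]

theorem letter (a : S) : IsScaledSRE (Set.indicator {[a]} (1 : List S → ℝ≥0∞)) :=
  Or.inr ⟨1, one_ne_zero, .letter a, trivial, funext fun w => by simp [SRE.sem]⟩

/-- The proper star of a scaled regular expression of mass less than one. -/
theorem exists_plus {f : List S → ℝ≥0∞} (hf : IsScaledSRE f) (h1 : ∑' w, f w < 1) :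
    ∃ g, IsScaledSRE g ∧ ∀ w, g w = f w + WordSeries.conv f g w := by
  rcases hf with rfl | ⟨c, hc, r, hr, rfl⟩
  · exact ⟨_, zero, fun w => by simp [conv_zero_left]⟩
  rw [ENNReal.tsum_mul_left, SRE.tsum_sem_of_epsFree hr, mul_one] at h1
  have hc1 : c < 1 := by exact_mod_cast h1
  have hd : 1 - c ≠ 0 := (tsub_pos_of_lt hc1).ne'
  have hcd : (1 : ℝ≥0∞) - ((1 - c : ℝ≥0) : ℝ≥0∞) = c := by
    rw [ENNReal.coe_sub, ENNReal.coe_one, ENNReal.sub_sub_cancel ENNReal.one_ne_top h1.le]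
  have hq : ((c / (1 - c) : ℝ≥0) : ℝ≥0∞) * ((1 - c : ℝ≥0) : ℝ≥0∞) = c := by
    exact_mod_cast div_mul_cancel₀ c hd
  -- With parameter 1 - c, the k-th power of `⟦r⟧` has weight (1 - c)c^(k-1) in the star; the factor
  -- c/(1 - c) turns this into c^k.
  let p : Set.Ioo (0 : ℝ≥0) 1 :=
    ⟨1 - c, tsub_pos_of_lt hc1, tsub_lt_self one_pos (pos_iff_ne_zero.2 hc)⟩
  refine ⟨fun w => ((c / (1 - c) : ℝ≥0) : ℝ≥0∞) * (SRE.star p r).sem w,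
    Or.inr ⟨_, div_ne_zero hc hd, .star p r, hr, rfl⟩, fun w => ?_⟩
  beta_reduce
  rw [SRE.sem_star_eq_add_conv hr, conv_mul_left, conv_mul_right, mul_add, ← mul_assoc]
  simp only [p, hq, hcd]
  ring

/-- Solutions of finite mass of linear equations over scaled regular expressions. -/
theorem of_linear_equation {f h X : List S → ℝ≥0∞} (hf : IsScaledSRE f) (hh : IsScaledSRE h)
    (hf1 : ∑' w, f w < 1) (hX : ∀ w, X w = h w + WordSeries.conv f X w) : IsScaledSRE X := by
  obtain ⟨g, hg, hgf⟩ := hf.exists_plus hf1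
  have hgf' : g = fun w => f w + WordSeries.conv f g w := funext hgf
  -- With `g` the plus of `f`, the candidate solution is h + g·h; uniqueness identifies it with `X`.
  have hY : ∀ w, (fun w => h w + WordSeries.conv g h w) w =
      h w + WordSeries.conv f (fun w => h w + WordSeries.conv g h w) w := by
    intro w
    beta_reduce
    rw [conv_add_right, ← conv_assoc, ← conv_add_left, ← hgf']
  rw [eq_of_linear_equation hf.apply_nil hX hY]
  exact hh.add (hg.conv hh)

end IsScaledSRE

end WordSeries

/-! ### Gelfand's formula and summability of powers -/

section SpectralRadius

open Filter Topology

/-- `rho` is defined by `toNNReal`, which sends ∞ to 0; finiteness ensures that nothing is lost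
there. -/
theorem spectralRadius_ne_top {B : Type*} [NormedRing B] [NormedAlgebra ℂ B] [CompleteSpace B]
    (b : B) : spectralRadius ℂ b ≠ ∞ := by
  have h := spectrum.spectralRadius_le_pow_nnnorm_pow_one_div ℂ b 0
  refine ne_top_of_le_ne_top ?_ h
  simp [ENNReal.mul_eq_top]

theorem tsum_inv_pow_mul_nnnorm_pow_lt_top {B : Type*} [NormedRing B] [NormedAlgebra ℂ B]
    [CompleteSpace B] (b : B) {ζ : ℝ≥0} (h : spectralRadius ℂ b < ζ) :
    ∑' n : ℕ, ((ζ⁻¹ ^ n * ‖b ^ n‖₊ : ℝ≥0) : ℝ≥0∞) < ∞ := by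
  obtain ⟨s, hs, hsζ⟩ := ENNReal.lt_iff_exists_nnreal_btwn.1 h
  have hsζ' : s < ζ := by exact_mod_cast hsζ
  have hζ : 0 < ζ := (zero_le : 0 ≤ s).trans_lt hsζ'
  -- By Gelfand's formula the n-th roots of the norms eventually fall below `s`, leaving a geometric
  -- series of ratio s/ζ < 1.
  have hev : ∀ᶠ n : ℕ in atTop, ‖b ^ n‖₊ ≤ s ^ n := by
    filter_upwards [(spectrum.pow_nnnorm_pow_one_div_tendsto_nhds_spectralRadius b).eventually
      (gt_mem_nhds hs), eventually_gt_atTop 0] with n hn hn0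
    have hn0' : (n : ℝ) ≠ 0 := by exact_mod_cast hn0.ne'
    have := ENNReal.rpow_le_rpow hn.le (Nat.cast_nonneg n)
    rw [← ENNReal.rpow_mul, one_div, inv_mul_cancel₀ hn0', ENNReal.rpow_one,
      ENNReal.rpow_natCast] at this
    exact_mod_cast this
  have hgeom : Summable fun n : ℕ => (((ζ⁻¹ * s) ^ n : ℝ≥0) : ℝ) := by
    have h1 : ζ⁻¹ * s < 1 := by
      rw [mul_comm, ← div_eq_mul_inv]
      exact (div_lt_one hζ).2 hsζ'
    exact NNReal.summable_coe.2 (NNReal.summable_geometric h1)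
  have hsum : Summable fun n : ℕ => ((ζ⁻¹ ^ n * ‖b ^ n‖₊ : ℝ≥0) : ℝ) := by
    refine hgeom.of_norm_bounded_eventually_nat ?_
    filter_upwards [hev] with n hn
    rw [NNReal.norm_eq, mul_pow]
    exact_mod_cast mul_le_mul_right hn _
  exact lt_top_iff_ne_top.2 (ENNReal.tsum_coe_ne_top_iff_summable.2 (NNReal.summable_coe.1 hsum))

end SpectralRadius

/-! ### Path series and state elimination -/

namespace WeightedAutomaton

variable {S Q : Type*}

theorem joint_rescale [Fintype S] (A : WeightedAutomaton S Q) (ζ : ℝ≥0) :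
    (A.rescale ζ).joint = ζ⁻¹ • A.joint := by
  simp [joint, rescale, Finset.smul_sum]

/-- The series of all nonempty paths from `i` to `j` with intermediate states in `T`. -/
noncomputable def pathSeries (A : WeightedAutomaton S Q) (T : Finset Q) (j : Q) :
    Q → List S → ℝ≥0∞
  | _, [] => 0
  | i, a :: w => (if w = [] then (A.trans a i j : ℝ≥0∞) else 0) +
      ∑ k ∈ T, (A.trans a i k : ℝ≥0∞) * A.pathSeries T j k w

theorem pathSeries_cons (A : WeightedAutomaton S Q) (T : Finset Q) (i j : Q) (a : S)
    (w : List S) : A.pathSeries T j i (a :: w) = (if w = [] then (A.trans a i j : ℝ≥0∞) else 0) +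
      ∑ k ∈ T, (A.trans a i k : ℝ≥0∞) * A.pathSeries T j k w := by
  rw [pathSeries]

theorem pathSeries_nil (A : WeightedAutomaton S Q) (T : Finset Q) (i j : Q) :
    A.pathSeries T j i [] = 0 := by
  rw [pathSeries]

theorem pathSeries_mono (A : WeightedAutomaton S Q) {T T' : Finset Q} (hT : T ⊆ T') (i j : Q)
    (w : List S) : A.pathSeries T j i w ≤ A.pathSeries T' j i w := by
  induction w generalizing i with
  | nil => simp [pathSeries_nil]
  | cons a w ih =>
    rw [pathSeries_cons, pathSeries_cons]
    exact add_le_add le_rfl ((Finset.sum_le_sum fun k _ => mul_le_mul_right (ih k) _).trans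
      (Finset.sum_le_sum_of_subset hT))

/-- Paths are decomposed at their first visit to the state `q`. -/
theorem pathSeries_insert [DecidableEq Q] (A : WeightedAutomaton S Q) {T : Finset Q} {q : Q} (hq : q ∉ T)
    (i j : Q) (w : List S) : A.pathSeries (insert q T) j i w = A.pathSeries T j i w +
      conv (A.pathSeries T q i) (A.pathSeries (insert q T) j q) w := by
  induction w generalizing i with
  | nil => simp [pathSeries_nil, conv_nil]
  | cons a w ih =>
    rw [conv_cons, pathSeries_nil, zero_mul, zero_add]
    simp only [pathSeries_cons A T]
    rw [conv_add_left, conv_sum_left, pathSeries_cons, Finset.sum_insert hq]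
    simp_rw [conv_mul_left, conv_ite_nil_left]
    rw [Finset.sum_congr rfl fun k _ => by rw [ih k]]
    simp_rw [mul_add, Finset.sum_add_distrib]
    ring

variable [Fintype Q] [DecidableEq Q]

theorem pathSeries_univ (A : WeightedAutomaton S Q) (i j : Q) {w : List S} (hw : w ≠ []) :
    A.pathSeries Finset.univ j i w = ((w.map A.trans).prod i j : ℝ≥0∞) := by
  induction w generalizing i with
  | nil => exact absurd rfl hw
  | cons a w ih =>
    rw [pathSeries_cons]
    by_cases h : w = []
    · simp [h, pathSeries_nil]
    · simp [h, ih, Matrix.mul_apply]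

theorem behavior_eq_pow_mul_behavior_rescale (A : WeightedAutomaton S Q) {ζ : ℝ≥0} (hζ : ζ ≠ 0)
    (w : List S) : A.behavior w = ζ ^ w.length * (A.rescale ζ).behavior w := by
  have h : (w.map A.trans).prod = ζ ^ w.length • (w.map (A.rescale ζ).trans).prod := by
    induction w with
    | nil => simp
    | cons a w ih =>
      have ha : A.trans a = ζ • (A.rescale ζ).trans a := by
        simp [rescale, smul_smul, mul_inv_cancel₀ hζ]
      simp only [List.map_cons, List.prod_cons, List.length_cons, ih]
      rw [ha, smul_mul_smul_comm, pow_succ']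
  rw [behavior, h, Matrix.smul_mulVec, dotProduct_smul, smul_eq_mul]
  rfl

variable [Fintype S]

section Rescale

attribute [local instance] Matrix.linftyOpNormedRing Matrix.linftyOpNormedAlgebra

theorem spectralRadius_joint_eq_rho (A : WeightedAutomaton S Q) :
    spectralRadius ℂ (A.joint.map fun x : ℝ≥0 => ((x : ℝ) : ℂ)) = A.rho :=
  (ENNReal.coe_toNNReal (spectralRadius_ne_top _)).symm

theorem tsum_pow_joint_rescale_lt_top (A : WeightedAutomaton S Q) {ζ : ℝ≥0} (h : A.rho < ζ)
    (i j : Q) : ∑' n : ℕ, (((A.rescale ζ).joint ^ n) i j : ℝ≥0∞) < ∞ := by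
  set b : Matrix Q Q ℂ := A.joint.map fun x : ℝ≥0 => ((x : ℝ) : ℂ) with hb
  have hlt : spectralRadius ℂ b < ζ := by
    rw [hb, spectralRadius_joint_eq_rho]
    exact_mod_cast h
  refine lt_of_le_of_lt (ENNReal.tsum_le_tsum fun n => ?_)
    (tsum_inv_pow_mul_nnnorm_pow_lt_top b hlt)
  let φ : ℝ≥0 →+* ℂ := Complex.ofRealHom.comp NNReal.toRealHom
  have hpow : b ^ n = (A.joint ^ n).map φ := (Matrix.map_pow A.joint φ n).symm
  -- The ℓ∞ operator norm is the largest absolute row sum, hence dominates every entry.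
  have hentry : (A.joint ^ n) i j ≤ ‖b ^ n‖₊ := by
    have h1 : ‖(b ^ n) i j‖₊ = (A.joint ^ n) i j := by
      rw [hpow]
      ext
      simp [φ]
    rw [← h1, Matrix.linfty_opNNNorm_def]
    exact (Finset.single_le_sum (f := fun j => ‖(b ^ n) i j‖₊) (fun _ _ => zero_le)
      (Finset.mem_univ j)).trans
      (Finset.le_sup (f := fun i => ∑ j, ‖(b ^ n) i j‖₊) (Finset.mem_univ i))
  rw [joint_rescale, smul_pow, Matrix.smul_apply, smul_eq_mul]
  exact_mod_cast mul_le_mul_right hentry _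

end Rescale

theorem tsum_prod_trans_eq_tsum_pow_joint (A : WeightedAutomaton S Q) (i j : Q) :
    ∑' w : List S, ((w.map A.trans).prod i j : ℝ≥0∞) = ∑' n : ℕ, ((A.joint ^ n) i j : ℝ≥0∞) := by
  have hlen : ∀ (n : ℕ) (i : Q),
      ∑' w : List S, (if w.length = n then ((w.map A.trans).prod i j : ℝ≥0∞) else 0) =
        ((A.joint ^ n) i j : ℝ≥0∞) := by
    intro n
    induction n with
    | zero => intro i; rw [tsum_list]; simp
    | succ n ih =>
      intro i
      rw [tsum_list, pow_succ', Matrix.mul_apply]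
      have (a : S) (w : List S) : (if (a :: w).length = n + 1 then
          ((((a :: w).map A.trans).prod i j : ℝ≥0) : ℝ≥0∞) else 0) =
          ∑ k, (A.trans a i k : ℝ≥0∞) *
            (if w.length = n then ((w.map A.trans).prod k j : ℝ≥0∞) else 0) := by
        simp only [List.length_cons, Nat.add_right_cancel_iff, List.map_cons, List.prod_cons,
          Matrix.mul_apply]
        split_ifs <;> simp
      simp_rw [this]
      rw [if_neg (by simp), zero_add, tsum_fintype]
      simp_rw [Summable.tsum_finsetSum (fun _ _ => ENNReal.summable), ENNReal.tsum_mul_left, ih]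
      rw [Finset.sum_comm]
      simp [joint, Matrix.sum_apply, Finset.sum_mul]
  simp_rw [← hlen]
  rw [ENNReal.tsum_comm]
  exact tsum_congr fun w => by simp

/-- Kleene's construction by induction on the allowed intermediate states. Monotonicity in `T`
passes the finiteness hypothesis for all states on to every stage. -/
theorem isScaledSRE_pathSeries (A : WeightedAutomaton S Q)
    (hfin : ∀ i j, ∑' w, A.pathSeries Finset.univ j i w < ∞) (T : Finset Q) (i j : Q) :
    IsScaledSRE (A.pathSeries T j i) := by
  classical
  induction T using Finset.induction_on generalizing i j with
  | empty =>
    have : A.pathSeries ∅ j i = fun w =>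
        ∑ a, (A.trans a i j : ℝ≥0∞) * Set.indicator {[a]} (1 : List S → ℝ≥0∞) w := by
      funext w
      cases w with
      | nil => simp [pathSeries_nil]
      | cons b w =>
        rw [pathSeries_cons, Finset.sum_eq_single b]
        · by_cases h : w = [] <;> simp [h]
        · intro a _ hab
          simp [hab.symm]
        · simp
    rw [this]
    exact IsScaledSRE.sum _ fun a _ => (IsScaledSRE.letter a).const_mul _
  | insert q T hq ih =>
    -- Let P be the mass of first-return loops at `q` and X that of all loops through `insert q T`.
    -- Then X = P + PX, and P ≥ 1 would give X ≥ 1 + X with X finite.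
    have hlt : ∑' w, A.pathSeries T q q w < 1 := by
      by_contra! h1
      have hX : ∑' w, A.pathSeries (insert q T) q q w ≠ ∞ :=
        ((ENNReal.tsum_le_tsum fun w =>
          A.pathSeries_mono (Finset.subset_univ _) q q w).trans_lt (hfin q q)).ne
      have heq : ∑' w, A.pathSeries (insert q T) q q w = ∑' w, A.pathSeries T q q w +
          (∑' w, A.pathSeries T q q w) * ∑' w, A.pathSeries (insert q T) q q w := by
        conv_lhs => rw [tsum_congr fun w => A.pathSeries_insert hq q q w]
        rw [ENNReal.tsum_add, tsum_conv]
      have : 1 + ∑' w, A.pathSeries (insert q T) q q w ≤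
          0 + ∑' w, A.pathSeries (insert q T) q q w := by
        conv_rhs => rw [zero_add, heq]
        exact add_le_add h1 (le_mul_of_one_le_left zero_le h1)
      exact absurd ((ENNReal.add_le_add_iff_right hX).1 this) (by simp)
    have hq' : IsScaledSRE (A.pathSeries (insert q T) j q) :=
      IsScaledSRE.of_linear_equation (ih q q) (ih q j) hlt (A.pathSeries_insert hq q j)
    rw [show A.pathSeries (insert q T) j i = _ from funext (A.pathSeries_insert hq i j)]
    exact (ih i j).add ((ih i q).conv hq')

/-- The behavior of an automaton with the empty word removed. -/
theorem isScaledSRE_behavior (A : WeightedAutomaton S Q)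
    (hfin : ∀ i j, ∑' n : ℕ, ((A.joint ^ n) i j : ℝ≥0∞) < ∞) :
    IsScaledSRE fun w => if w = [] then 0 else (A.behavior w : ℝ≥0∞) := by
  have hpath : ∀ i j, ∑' w, A.pathSeries Finset.univ j i w < ∞ := by
    intro i j
    refine lt_of_le_of_lt (ENNReal.tsum_le_tsum fun w => ?_)
      ((A.tsum_prod_trans_eq_tsum_pow_joint i j).trans_lt (hfin i j))
    by_cases hw : w = []
    · simp [hw, pathSeries_nil]
    · rw [A.pathSeries_univ i j hw]
  have : (fun w => if w = [] then 0 else (A.behavior w : ℝ≥0∞)) = fun w =>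
      ∑ i, ∑ j, ((A.init i * A.final j : ℝ≥0) : ℝ≥0∞) * A.pathSeries Finset.univ j i w := by
    funext w
    by_cases hw : w = []
    · simp [hw, pathSeries_nil]
    · simp only [if_neg hw, A.pathSeries_univ _ _ hw, behavior, dotProduct, Matrix.mulVec]
      push_cast
      refine Finset.sum_congr rfl fun i _ => ?_
      rw [Finset.mul_sum]
      exact Finset.sum_congr rfl fun j _ => by ring
  rw [this]
  exact IsScaledSRE.sum _ fun i _ => IsScaledSRE.sum _ fun j _ =>
    (A.isScaledSRE_pathSeries hpath _ i j).const_mul _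

/-- An automaton whose behavior is nonzero and whose powers of the joint matrix are summable
computes a positive multiple of the semantics of a stochastic regular expression. -/
theorem exists_behavior_eq_mul_sem (A : WeightedAutomaton S Q) (hA : ∃ w, A.behavior w ≠ 0)
    (hfin : ∀ i j, ∑' n : ℕ, ((A.joint ^ n) i j : ℝ≥0∞) < ∞) :
    ∃ c : ℝ≥0, c ≠ 0 ∧ ∃ r : SRE S, ∑' w, r.sem w = 1 ∧ (A.behavior [] = 0 → r.EpsFree) ∧
      ∀ w, (A.behavior w : ℝ≥0∞) = c * r.sem w := by
  set b := A.behavior [] with hb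
  have heps : ∀ w : List S, SRE.eps.sem w = if w = [] then 1 else 0 := fun w => by
    simp [SRE.sem, Set.indicator_apply]
  have hsplit : ∀ w, (A.behavior w : ℝ≥0∞) =
      b * SRE.eps.sem w + if w = [] then 0 else (A.behavior w : ℝ≥0∞) := fun w => by
    by_cases hw : w = [] <;> simp [heps, hw, hb]
  have heps1 : ∑' w : List S, SRE.eps.sem w = 1 := SRE.tsum_indicator_singleton []
  rcases A.isScaledSRE_behavior hfin with h0 | ⟨c, hc, r, hr, hcr⟩
  · have h (w : List S) : (A.behavior w : ℝ≥0∞) = b * SRE.eps.sem w := by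
      rw [hsplit w, congrFun h0 w, add_zero]
    have hb0 : b ≠ 0 := by
      obtain ⟨w, hw⟩ := hA
      intro h1
      have := h w
      rw [h1, ENNReal.coe_zero, zero_mul] at this
      exact hw (by exact_mod_cast this)
    exact ⟨b, hb0, .eps, heps1, fun h1 => absurd h1 hb0, h⟩
  · have h (w : List S) : (A.behavior w : ℝ≥0∞) = b * SRE.eps.sem w + c * r.sem w := by
      rw [hsplit w, congrFun hcr w]
    by_cases hb0 : b = 0
    · exact ⟨c, hc, r, SRE.tsum_sem_of_epsFree hr, fun _ => hr, fun w => by simp [h w, hb0]⟩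
    -- The weights `b` of the empty word and `c` of the nonempty words are normalized to a convex
    -- combination.
    · obtain ⟨p, hp₁, hp₂⟩ := exists_convex_weight hb0 hc
      refine ⟨b + c, by positivity, .choice p .eps r,
        SRE.tsum_sem_choice p heps1 (SRE.tsum_sem_of_epsFree hr), fun h1 => absurd h1 hb0,
        fun w => ?_⟩
      rw [h w, SRE.sem.eq_3, mul_add, ← mul_assoc, ← mul_assoc, hp₁, hp₂]

end WeightedAutomaton

theorem theorem4p3 {S Q : Type*} [Fintype S] [Fintype Q] [DecidableEq Q]
    (A : WeightedAutomaton S Q) (hA : ∃ w, A.behavior w ≠ 0) (ζ : ℝ≥0)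
    (hζ : (0 < A.rho ∧ ∃ ε : ℝ≥0, 0 < ε ∧ ζ = (1 + ε) * A.rho) ∨ (A.rho = 0 ∧ 0 < ζ)) :
    0 < (A.rescale ζ).mass ∧ (A.rescale ζ).mass < ∞ ∧
      ∃ r : SRE S,
        ∑' w : List S, r.sem w = 1 ∧
        (A.behavior [] = 0 → r.EpsFree) ∧
        ∀ w : List S,
          (A.behavior w : ℝ≥0∞) = (ζ : ℝ≥0∞) ^ w.length * (A.rescale ζ).mass * r.sem w := by
  have hlt : A.rho < ζ := by
    rcases hζ with ⟨hρ, ε, hε, rfl⟩ | ⟨hρ, hζ⟩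
    · exact lt_mul_of_one_lt_left hρ (lt_add_of_pos_right 1 hε)
    · rwa [hρ]
  have hscale := A.behavior_eq_pow_mul_behavior_rescale (zero_le.trans_lt hlt).ne'
  obtain ⟨w₀, hw₀⟩ := hA
  obtain ⟨c, hc, r, hr1, hr, h⟩ := (A.rescale ζ).exists_behavior_eq_mul_sem
    ⟨w₀, fun h0 => hw₀ (by rw [hscale, h0, mul_zero])⟩ (A.tsum_pow_joint_rescale_lt_top hlt)
  have hmass : (A.rescale ζ).mass = c := by
    rw [WeightedAutomaton.mass, tsum_congr h, ENNReal.tsum_mul_left, hr1, mul_one]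
  rw [hmass]
  refine ⟨by exact_mod_cast pos_iff_ne_zero.2 hc, ENNReal.coe_lt_top, r, hr1, fun h0 => hr ?_,
    fun w => ?_⟩
  · simpa [hscale []] using h0
  · rw [hscale w, ENNReal.coe_mul, ENNReal.coe_pow, h w, mul_assoc]
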